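/- Let $u\in\mathbb C$ be a primitive fifth root of unity and put $y=u^2+u^3$. Let $T$ be a diagram of a long link in the plane: the diagram (with under/over information at the crossings) of one long strand, closed up by a point at infinity, and possibly further closed components; it may be disconnected. It has exactly two unbounded faces $f$ and $g$. A *state* of $T$ colours every face white or black; it is forbidden if two faces adjacent along an edge are both black. For a state that is not forbidden, each crossing contributes a variable $x_{ijkl}$: draw the crossing with its overpass from northeast to southwest and let $i,j,k,l$ be the colours (0 for white, 1 for black) in the corners east, north, west, south; then $$x_{0000}=-u^2-u^3,\quad x_{0001}=x_{0100}=-u^3,\quad x_{0010}=x_{1000}=-u^2,\quad x_{0101}=u,\quad x_{1010}=u^4 .$$ A face $h$ of colour $i$ contributes $x_i^{\chi(h)}$, where $x_0=1$ is the facial variable of white, $x_1=y$ that of black, and $\chi(h)$ is the Euler characteristic of $h$ (so $\chi(h)=1$ for a disk; a face in the plane whose boundary, in the sphere, has $b$ components has $\chi(h)=2-b$). The value of a state is the product of these contributions over all crossings and faces, and $[T]_u$ is the sum of the values of all states that are not forbidden. A *partial state* places coloured dots in some faces. Its $u$-value is the sum over all states that are not forbidden and agree with the dots, where for each face with a dot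 one facial variable is left out (such a face of colour $i$ contributes $x_i^{\chi(h)-1}$; thus a disk with a dot contributes no facial factor). Then the partial state with a single black dot, placed in $f$, and the partial state with a single black dot, placed in $g$, have the same $u$-value, which we denote $\{T\}_u$. It is also the $u$-value of the partial state with one white dot in each of $f$ and $g$. Moreover $$[T]_u=(1+2y)\,\{T\}_u ,\qquad (1+2y)^2=5,\qquad [T]_u\in\sqrt5\,\mathbb Z[u].$$ -/

import Mathlib

/-! # Long links in the plane, their states, and the `u`-invariant

A diagram is handled up to isotopy, through its combinatorial structure.  The plane is completed to
the sphere by one point at infinity, which lies on the (closed up) long link. -/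

/-- The strand ends around the vertices of a diagram.  There are two kinds of vertices: crossings
`c : X`, with four ends, and points `p : P` of the link that are not crossings, with two ends
(subdivision points of the strands and the point at infinity).  The ends at a vertex are numbered in
anticlockwise order.  At a crossing drawn with its overpass from northeast to southwest the
ends `0, 1, 2, 3` point southeast, northeast, northwest, southwest: `0, 2` form the underpass and
`1, 3` the overpass. -/
abbrev StrandEnd (X P : Type*) : Type _ := (X × ZMod 4) ⊕ (P × ZMod 2)

/-- The next strand end, anticlockwise, at the same vertex. -/
def StrandEnd.turn (X P : Type*) : Equiv.Perm (StrandEnd X P) :=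
  Equiv.sumCongr ((Equiv.refl X).prodCongr (Equiv.addRight 1))
    ((Equiv.refl P).prodCongr (Equiv.addRight 1))

/-- The permutation describing the boundary walks of the faces, when the strand ends are joined in
pairs by `join`.  Leaving a vertex along the end `d`, with the face on the left, one arrives at the
other vertex by the end `join d`, and goes on along the end that precedes `join d` anticlockwise. -/
def StrandEnd.walk {X P : Type*} (join : Equiv.Perm (StrandEnd X P)) :
    Equiv.Perm (StrandEnd X P) :=
  join.trans (StrandEnd.turn X P).symm

/-- The boundary walks (the cycles of `StrandEnd.walk join`), in other words the
boundary components of the surface that results from thickening the diagram. -/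
def StrandEnd.Walk {X P : Type*} (join : Equiv.Perm (StrandEnd X P)) : Type _ :=
  Quotient (Equiv.Perm.SameCycle.setoid (StrandEnd.walk join))

/-- The number of boundary components of the face `f`, where `face d` is the face in the corner
between the end `d` and the next end anticlockwise. -/
noncomputable def StrandEnd.boundaryCount {X P F : Type*} (join : Equiv.Perm (StrandEnd X P))
    (face : StrandEnd X P → F) (f : F) : ℕ :=
  Nat.card {w : StrandEnd.Walk join // ∃ d, Quotient.mk _ d = w ∧ face d = f}

/-- A diagram of a long link in the plane, possibly with further closed components, and possibly
disconnected, with set of crossings `X`, set of other marked points `P` and set of faces `F`.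

The strand ends are joined in pairs by edges.  A face of a diagram on the sphere is a sphere with
`b ≥ 1` holes, one for each of its boundary walks, and so has Euler characteristic `2 - b`.  The
vertices, edges and faces are glued to a closed oriented surface; it is a sphere
exactly if it is connected and has Euler characteristic `2`, where vertices and edges together
contribute `(|X| + |P|) - (2|X| + |P|) = -|X|`. -/
structure LongLink (X P F : Type*) [Fintype X] [Fintype P] [Fintype F] where
  /-- The other end of an edge. -/
  join : Equiv.Perm (StrandEnd X P)
  join_join : ∀ d, join (join d) = d
  join_ne : ∀ d, join d ≠ d
  /-- The face in the corner between an end and the next end anticlockwise at the same vertex. -/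
  face : StrandEnd X P → F
  face_walk : ∀ d, face (StrandEnd.walk join d) = face d
  face_surjective : Function.Surjective face
  connected : ∀ d d', Relation.EqvGen
    (fun a b => b = StrandEnd.turn X P a ∨ b = join a ∨ face a = face b) d d'
  euler : - (Fintype.card X : ℤ) + ∑ f : F, (2 - (StrandEnd.boundaryCount join face f : ℤ)) = 2
  /-- The point at infinity, through which the long component passes. -/
  infinity : P

/-- The two symbols. -/
inductive Dot : Type
  | white
  | black
  deriving DecidableEq

instance : Fintype Dot := ⟨{Dot.white, Dot.black}, by rintro (_ | _) <;> simp⟩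

/-- A partial state: a relation that places zero or more coloured dots in each face. -/
abbrev PartialState (F : Type*) : Type _ := F → Set Dot

/-- The partial state with exactly one dot, of colour `c`, in the face `f`. -/
def PartialState.single {F : Type*} (f : F) (c : Dot) : PartialState F :=
  fun g => {c' | g = f ∧ c' = c}

/-- Putting all the dots of two partial states. -/
def PartialState.both {F : Type*} (p q : PartialState F) : PartialState F :=
  fun g => p g ∪ q g

/-- The facial variables `x = 1` (white) and `y = u ^ 2 + u ^ 3` (black). -/
noncomputable def facialVar (u : ℂ) : Dot → ℂ
  | .white => 1
  | .black => u ^ 2 + u ^ 3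

open Dot in
/-- The variable of a crossing drawn with its overpass from northeast to southwest, where the
four symbols are those in the corners east, north, west, south.  It is zero if two
consecutive corners are black. -/
noncomputable def crossingVar (u : ℂ) : Dot → Dot → Dot → Dot → ℂ
  | white, white, white, white => - u ^ 2 - u ^ 3
  | white, white, white, black => - u ^ 3
  | white, white, black, white => - u ^ 2
  | white, black, white, white => - u ^ 3
  | black, white, white, white => - u ^ 2
  | white, black, white, black => u
  | black, white, black, white => u ^ 4
  | _, _, _, _ => 0

namespace LongLink

variable {X P F : Type*} [Fintype X] [Fintype P] [Fintype F]

/-- One of the two unbounded faces. -/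
def unboundedFace₁ (T : LongLink X P F) : F := T.face (Sum.inr (T.infinity, 0))

/-- The other unbounded face. -/
def unboundedFace₂ (T : LongLink X P F) : F := T.face (Sum.inr (T.infinity, 1))

/-- The Euler characteristic of a face (the point at infinity is not in a face). -/
noncomputable def eulerChar (T : LongLink X P F) (f : F) : ℤ :=
  2 - (StrandEnd.boundaryCount T.join T.face f : ℤ)

/-- A state is forbidden if the faces on the two sides of some edge are both black. -/
def Forbidden (T : LongLink X P F) (σ : F → Dot) : Prop :=
  ∃ d, σ (T.face d) = Dot.black ∧ σ (T.face (T.join d)) = Dot.black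

/-- The variable that a state `σ` yields at the crossing `c`. -/
noncomputable def crossingFactor (T : LongLink X P F) (u : ℂ) (σ : F → Dot) (c : X) : ℂ :=
  crossingVar u (σ (T.face (Sum.inl (c, 0)))) (σ (T.face (Sum.inl (c, 1))))
    (σ (T.face (Sum.inl (c, 2)))) (σ (T.face (Sum.inl (c, 3))))

open Classical in
/-- The contribution of the face `f`, where the dots of `p` were placed beforehand.  A face `f` with
symbol `i` contributes `x_i ^ χ(f)`; if `p` already has a dot in `f` then one factor `x_i` is not
counted.  So a face that is a disk, `χ(f) = 1`, contributes `x_i` or, if it has a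
preassigned dot, nothing; and in a connected diagram all faces are disks. -/
noncomputable def facialFactor (T : LongLink X P F) (u : ℂ) (p : PartialState F) (σ : F → Dot)
    (f : F) : ℂ :=
  if p f = ∅ then facialVar u (σ f) ^ T.eulerChar f else facialVar u (σ f) ^ (T.eulerChar f - 1)

open Classical in
/-- The `u`-value of a partial state `p`: the sum, over the states that are not forbidden and that
extend `p`, of the products of all contributions of crossings and faces.  (It is zero if `p` is
inconsistent, as then no state extends `p`.) -/
noncomputable def partialValue (T : LongLink X P F) (u : ℂ) (p : PartialState F) : ℂ :=
  ∑ σ : F → Dot, if (∀ f, ∀ c ∈ p f, σ f = c) ∧ ¬ T.Forbidden σ then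
    (∏ c, T.crossingFactor u σ c) * ∏ f, T.facialFactor u p σ f else 0

/-- The value `[T]_u` of the `u`-invariant: the sum over all states, with no dots preassigned. -/
noncomputable def value (T : LongLink X P F) (u : ℂ) : ℂ :=
  T.partialValue u (fun _ => ∅)

end LongLink

/-! # The `u`-invariant of a long link is `1 + 2y` times the value of a partial state

Write `y = u ^ 2 + u ^ 3`, so that `y ^ 2 = 1 - y`.  The state model is that of a Kauffman bracket
with loop value `1 + y = y⁻¹`: where no two consecutive corners are black, the crossing variable is
`-u ^ 3 * [i = k] / x_i - u ^ 2 * [j = l] / x_j` (`crossingVar_eq`).  The condition `i = k` together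
with the factor `1 / x_i` means that the opposite corners are joined by a band, because a band lowers
the Euler characteristic by one, whether it joins two faces or a face to itself
(`SmoothedDiagram.exists_smooth`).  So a state sum over a diagram is a linear combination of state
sums over its two smoothings at a crossing, whatever weight is given to the symbol of one face.

When all crossings are smoothed, disjoint circles on the sphere remain.  That their dual graph is a
tree, in which a face with `n` neighbours has Euler characteristic `2 - n`, follows by counting
(`SmoothedDiagram.dualGraph_isTree`): joining opposite corners by a band multiplies the permutation
of the boundary walks by a transposition, which bounds the number of walks from above, so the Euler
characteristics are at most `2 - n`; they still add up to `2`, and a connected graph has at most one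
vertex more than it has edges.

On a tree, the sum over the symbol of a leaf yields the factor `1 + y`.  Removing leaves other than
a chosen face (`sum_states_tree`) shows that a weight `φ` of the symbol of that face leads to a
state sum `K * (φ white + φ black * y ^ 2)`, where the factor `K` in `ℤ[u]` does not depend
on the face (`SmoothedDiagram.exists_stateSum_eq`).  A black dot thus has value `K * y` in
every face, no dot yields `K * (1 + y ^ 2) = (1 + 2 * y) * (K * y)`, and
`K * (1 + y ^ 2) - 2 * K * y ^ 2 = K * y` remains for two white dots, since the two unbounded faces
are never both black. -/

/-! ### Cycles of a permutation multiplied by a transposition -/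

/-- The number of cycles of `w` that meet `s`. -/
noncomputable def cycleCount {D : Type*} (w : Equiv.Perm D) (s : Set D) : ℕ :=
  (Quotient.mk (Equiv.Perm.SameCycle.setoid w) '' s).ncard

section Cycles

variable {D : Type*} [Finite D]

theorem mem_of_sameCycle_of_mapsTo {w : Equiv.Perm D} {s : Set D} (hs : ∀ x ∈ s, w x ∈ s)
    {x y : D} (hx : x ∈ s) (h : w.SameCycle x y) : y ∈ s := by
  obtain ⟨n, -, rfl⟩ := h.exists_pow_eq'
  clear h
  induction n with
  | zero => simpa using hx
  | succ n ih => rw [pow_succ', Equiv.Perm.mul_apply]; exact hs _ ih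

/-- A function that is constant along `w` inside an invariant set is constant on cycles there. -/
theorem eq_of_sameCycle_of_mapsTo {α : Type*} {w : Equiv.Perm D} {s : Set D} {g : D → α}
    (hs : ∀ x ∈ s, w x ∈ s) (hg : ∀ x ∈ s, g (w x) = g x) {x y : D} (hx : x ∈ s)
    (h : w.SameCycle x y) : g x = g y :=
  (mem_of_sameCycle_of_mapsTo (s := s ∩ {z | g z = g x})
    (fun z hz => ⟨hs z hz.1, (hg z hz.1).trans hz.2⟩) ⟨hx, rfl⟩ h).2.symm

theorem ncard_image_le_of_factors {α β : Type*} {s : Set D} (f : D → α) (g : D → β)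
    (h : ∀ x ∈ s, ∀ y ∈ s, f x = f y → g x = g y) : (g '' s).ncard ≤ (f '' s).ncard := by
  rcases isEmpty_or_nonempty D with hD | hD
  · simp [Set.eq_empty_of_isEmpty s]
  have hex : ∀ q ∈ g '' s, ∃ x, x ∈ s ∧ g x = q := fun q hq => hq
  choose! r hrs hr using hex
  refine Set.ncard_le_ncard_of_injOn (fun q => f (r q))
    (fun q hq => Set.mem_image_of_mem f (hrs q hq)) ?_ ((Set.toFinite s).image f)
  intro q hq q' hq' hqq
  rw [← hr q hq, ← hr q' hq']
  exact h _ (hrs q hq) _ (hrs q' hq') hqq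

/-- If `g` is constant along `w` on an invariant set, it has at most as many values there as there
are cycles. -/
theorem ncard_image_le_cycleCount {α : Type*} {w : Equiv.Perm D} {s : Set D} {g : D → α}
    (hs : ∀ x ∈ s, w x ∈ s) (hg : ∀ x ∈ s, g (w x) = g x) :
    (g '' s).ncard ≤ cycleCount w s :=
  ncard_image_le_of_factors _ _ fun _ hx _ _ h =>
    eq_of_sameCycle_of_mapsTo hs hg hx (Quotient.exact h)

variable [DecidableEq D]

/-- Multiplying by the transposition of two points in distinct cycles joins these cycles. -/
theorem sameCycle_swap_mul {w : Equiv.Perm D} {a b : D} (h : ¬ w.SameCycle a b) :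
    (Equiv.swap a b * w).SameCycle a b := by
  by_contra hab
  set v := Equiv.swap a b * w with hv
  -- The predecessor `z` of `a` is sent to `b`, so it lies in the new cycle of `b`; were `a` not in
  -- that cycle, walking backwards from `z` would never leave it, although it leads to `a`.
  have hz : v (w⁻¹ a) = b := by simp [hv]
  have key : ∀ x ∈ {x | w.SameCycle a x ∧ v.SameCycle x b},
      w⁻¹ x ∈ {x | w.SameCycle a x ∧ v.SameCycle x b} := by
    rintro x ⟨hx, hxb⟩
    have h1 : x ≠ a := fun e => hab (e ▸ hxb)
    have h2 : x ≠ b := fun e => h (e ▸ hx)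
    have h3 : v (w⁻¹ x) = x := by simp [hv, Equiv.swap_apply_of_ne_of_ne h1 h2]
    refine ⟨Equiv.Perm.sameCycle_symm_apply_right.2 hx, ?_⟩
    rw [← Equiv.Perm.sameCycle_apply_left, h3]
    exact hxb
  have hmem : w⁻¹ a ∈ {x | w.SameCycle a x ∧ v.SameCycle x b} :=
    ⟨Equiv.Perm.sameCycle_symm_apply_right.2 (Equiv.Perm.SameCycle.refl _ _),
      Equiv.Perm.sameCycle_apply_left.1 (hz ▸ Equiv.Perm.SameCycle.refl _ _)⟩
  have hs : w⁻¹.SameCycle (w⁻¹ a) a := by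
    rw [Equiv.Perm.sameCycle_inv]
    exact Equiv.Perm.sameCycle_symm_apply_left.2 (Equiv.Perm.SameCycle.refl _ _)
  exact hab (mem_of_sameCycle_of_mapsTo key hmem hs).2

/-- Away from the two points, a transposition does not increase the number of cycles. -/
theorem cycleCount_swap_mul_le_of_notMem {w : Equiv.Perm D} {a b : D} {s : Set D}
    (hs : ∀ x ∈ s, w x ∈ s) (ha : a ∉ s) (hb : b ∉ s) :
    cycleCount (Equiv.swap a b * w) s ≤ cycleCount w s := by
  refine ncard_image_le_cycleCount hs fun x hx => ?_
  have h : (Equiv.swap a b * w) x = w x := by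
    rw [Equiv.Perm.mul_apply]
    exact Equiv.swap_apply_of_ne_of_ne (fun e => ha (e ▸ hs x hx)) (fun e => hb (e ▸ hs x hx))
  refine Quotient.sound ?_
  change Equiv.Perm.SameCycle _ _ _
  rw [← h, Equiv.Perm.sameCycle_apply_left]

/-- A transposition adds at most one cycle. -/
theorem cycleCount_swap_mul_le {w : Equiv.Perm D} {a b : D} {s : Set D}
    (hs : ∀ x ∈ s, w x ∈ s) :
    cycleCount (Equiv.swap a b * w) s ≤ cycleCount w s + 1 := by
  classical
  -- Identifying the new cycles of `a` and `b` loses at most one cycle, and what remains is a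
  -- quotient of the old cycles.
  set v := Equiv.swap a b * w with hv
  let q : D → Quotient (Equiv.Perm.SameCycle.setoid v) := Quotient.mk _
  let h : Quotient (Equiv.Perm.SameCycle.setoid v) → Quotient (Equiv.Perm.SameCycle.setoid v) :=
    fun c => if c = q b then q a else c
  have hva : ∀ x, q (v x) = q x := fun x => Quotient.sound
    (Equiv.Perm.sameCycle_apply_left.2 (Equiv.Perm.SameCycle.refl v x))
  have hle : ((h ∘ q) '' s).ncard ≤ cycleCount w s := by
    refine ncard_image_le_cycleCount hs fun x _ => ?_
    have hw : w x = Equiv.swap a b (v x) := by simp [hv]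
    rw [Function.comp, Function.comp, ← hva x, hw]
    rcases eq_or_ne (v x) a with e | e
    · rw [e, Equiv.swap_apply_left]; simp only [h]; split_ifs <;> simp_all
    · rcases eq_or_ne (v x) b with e' | e'
      · rw [e', Equiv.swap_apply_right]; simp only [h]; split_ifs <;> simp_all
      · rw [Equiv.swap_apply_of_ne_of_ne e e']
  calc cycleCount v s ≤ (insert (q b) ((h ∘ q) '' s)).ncard := by
        refine Set.ncard_le_ncard ?_ ((Set.toFinite _).insert _)
        rintro _ ⟨x, hx, rfl⟩
        by_cases hx' : q x = q b
        · exact Or.inl hx'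
        · exact Or.inr ⟨x, hx, if_neg hx'⟩
    _ ≤ ((h ∘ q) '' s).ncard + 1 := Set.ncard_insert_le _ _
    _ ≤ cycleCount w s + 1 := by omega

/-- A transposition of points in disjoint invariant sets joins two cycles. -/
theorem cycleCount_swap_mul_union {w : Equiv.Perm D} {a b : D} {s t : Set D}
    (hs : ∀ x ∈ s, w x ∈ s) (hst : Disjoint s t) (ha : a ∈ s) (hb : b ∈ t) :
    cycleCount (Equiv.swap a b * w) (s ∪ t) + 1 ≤ cycleCount w s + cycleCount w t := by
  have hab : ¬ w.SameCycle a b := fun h =>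
    Set.disjoint_left.1 hst (mem_of_sameCycle_of_mapsTo hs ha h) hb
  set v := Equiv.swap a b * w with hv
  have hvab : v.SameCycle a b := sameCycle_swap_mul hab
  let q : D → Quotient (Equiv.Perm.SameCycle.setoid v) := Quotient.mk _
  let p : D → Quotient (Equiv.Perm.SameCycle.setoid w) := Quotient.mk _
  have hva : ∀ x, q (v x) = q x := fun x => Quotient.sound
    (Equiv.Perm.sameCycle_apply_left.2 (Equiv.Perm.SameCycle.refl v x))
  have hqab : q a = q b := Quotient.sound hvab
  have hq : ∀ x, q (w x) = q x := by
    intro x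
    have hw : w x = Equiv.swap a b (v x) := by simp [hv]
    rw [← hva x, hw]
    rcases eq_or_ne (v x) a with e | e
    · rw [e, Equiv.swap_apply_left, hqab]
    · rcases eq_or_ne (v x) b with e' | e'
      · rw [e', Equiv.swap_apply_right, hqab]
      · rw [Equiv.swap_apply_of_ne_of_ne e e']
  have hpq : ∀ x y, p x = p y → q x = q y := fun x y h =>
    eq_of_sameCycle_of_mapsTo (s := Set.univ) (fun _ _ => trivial) (fun x _ => hq x) trivial
      (Quotient.exact h)
  let m : Quotient (Equiv.Perm.SameCycle.setoid w) → Quotient (Equiv.Perm.SameCycle.setoid v) :=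
    Quotient.lift q fun x y h => hpq x y (Quotient.sound h)
  have hsub : q '' (s ∪ t) ⊆ m '' ((p '' (s ∪ t)) \ {p b}) := by
    rintro _ ⟨x, hx, rfl⟩
    by_cases hxb : p x = p b
    · exact ⟨p a, ⟨⟨a, Or.inl ha, rfl⟩, fun e => hab (Quotient.exact e)⟩,
        hqab.trans (hpq _ _ hxb.symm)⟩
    · exact ⟨p x, ⟨⟨x, hx, rfl⟩, hxb⟩, rfl⟩
  calc cycleCount v (s ∪ t) + 1 ≤ ((p '' (s ∪ t)) \ {p b}).ncard + 1 :=
        Nat.add_le_add_right ((Set.ncard_le_ncard hsub (Set.toFinite _)).trans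
          (Set.ncard_image_le (Set.toFinite _))) 1
    _ = (p '' (s ∪ t)).ncard :=
        Set.ncard_sdiff_singleton_add_one ⟨b, Or.inr hb, rfl⟩ (Set.toFinite _)
    _ ≤ cycleCount w s + cycleCount w t := by
        rw [Set.image_union]; exact Set.ncard_union_le _ _

end Cycles

/-! ### The facial and crossing variables -/

theorem facialVar_black_sq {u : ℂ} (hu : IsPrimitiveRoot u 5) :
    facialVar u .black ^ 2 = 1 - facialVar u .black := by
  have h5 : u ^ 5 = 1 := hu.pow_eq_one
  have hs : 1 + u + u ^ 2 + u ^ 3 + u ^ 4 = 0 := by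
    have := hu.geom_sum_eq_zero (by norm_num)
    simpa [Finset.sum_range_succ] using this
  simp only [facialVar]
  linear_combination (2 + u) * h5 + hs

theorem facialVar_ne_zero {u : ℂ} (hu : IsPrimitiveRoot u 5) (c : Dot) : facialVar u c ≠ 0 := by
  cases c with
  | white => simp [facialVar]
  | black =>
    intro h
    have := facialVar_black_sq hu
    rw [h] at this
    norm_num at this

theorem facialVar_black_inv {u : ℂ} (hu : IsPrimitiveRoot u 5) :
    (facialVar u .black)⁻¹ = 1 + facialVar u .black := by
  have h := facialVar_black_sq hu
  refine inv_eq_of_mul_eq_one_right ?_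
  linear_combination h

theorem Dot.sum_univ {M : Type*} [AddCommMonoid M] (g : Dot → M) :
    ∑ c, g c = g .white + g .black := by
  change ∑ c ∈ {Dot.white, Dot.black}, g c = _
  rw [Finset.sum_pair (by decide)]

open Classical in
/-- Kauffman's skein relation: at a crossing where no two consecutive corners are black, the
variable of the crossing is a linear combination of those of its two smoothings, one of which joins
the east and west corners, the other one the north and south corners. -/
theorem crossingVar_eq {u : ℂ} (hu : IsPrimitiveRoot u 5) {i j k l : Dot}
    (hij : ¬ (i = .black ∧ j = .black)) (hjk : ¬ (j = .black ∧ k = .black))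
    (hkl : ¬ (k = .black ∧ l = .black)) (hli : ¬ (l = .black ∧ i = .black)) :
    crossingVar u i j k l = - u ^ 3 * (if i = k then (facialVar u i)⁻¹ else 0) +
      - u ^ 2 * (if j = l then (facialVar u j)⁻¹ else 0) := by
  have h5 : u ^ 5 = 1 := hu.pow_eq_one
  have hs : 1 + u + u ^ 2 + u ^ 3 + u ^ 4 = 0 := by
    have := hu.geom_sum_eq_zero (by norm_num)
    simpa [Finset.sum_range_succ] using this
  have hinv := facialVar_black_inv hu
  cases i <;> cases j <;> cases k <;> cases l <;>
    simp_all only [not_true_eq_false, and_self, and_true, and_false,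
      not_false_eq_true, if_true, reduceCtorEq, if_false, crossingVar, facialVar, inv_one]
  all_goals first
    | ring1
    | linear_combination h5 + hs
    | linear_combination -h5 - hs
    | linear_combination u * h5 + hs
    | linear_combination (1 + u) * h5 + hs

/-! ### States on trees -/

open Classical in
/-- The states on a finite tree, weighted as for a sphere that is cut by disjoint circles with this
dual tree: a face with `n` neighbours has Euler characteristic `2 - n`.  Removing a leaf different
from `r` amounts to summing over its symbol, which yields a factor `1 + y = y⁻¹`. -/
theorem sum_states_tree {u : ℂ} (hu : IsPrimitiveRoot u 5) :
    ∀ (n : ℕ) {V : Type*} [Fintype V] (G : SimpleGraph V), G.IsTree → Fintype.card V = n + 1 →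
      ∀ (r : V) (φ : Dot → ℂ),
      ∑ σ : V → Dot, (if ∃ v w, G.Adj v w ∧ σ v = .black ∧ σ w = .black then 0 else φ (σ r)) *
          ∏ v, facialVar u (σ v) ^ (2 - (G.degree v : ℤ)) =
        (1 + facialVar u .black) ^ n * (φ .white + φ .black * facialVar u .black ^ 2) := by
  intro n
  induction n with
  | zero =>
    intro V _ G _ hcard r φ
    have hsub : Subsingleton V := Fintype.card_le_one_iff_subsingleton.1 (by omega)
    have hU : Unique V := ⟨⟨r⟩, fun x => Subsingleton.elim _ _⟩
    have hadj : ∀ v w, ¬ G.Adj v w := fun v w h => h.ne (Subsingleton.elim _ _)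
    rw [← (Equiv.funUnique V Dot).symm.sum_comp]
    simp [Dot.sum_univ, hadj, facialVar]
  | succ n ih =>
    intro V _ G hG hcard r φ
    have : Nontrivial V := Fintype.one_lt_card_iff_nontrivial.1 (by omega)
    obtain ⟨v, hvr, hv⟩ : ∃ v, v ≠ r ∧ G.degree v = 1 := by
      obtain ⟨a, b, hab, ha, hb⟩ := hG.exists_ne_and_degree_eq_one
      by_cases h : a = r
      · exact ⟨b, fun e => hab (h.trans e.symm), hb⟩
      · exact ⟨a, h, ha⟩
    obtain ⟨p, hvp, hp⟩ := SimpleGraph.degree_eq_one_iff_existsUnique_adj.1 hv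
    have hpv : p ≠ v := hvp.ne'
    obtain ⟨H, hH, hHG⟩ : ∃ H : SimpleGraph {w // w ≠ v}, H.IsTree ∧
        ∀ a b, H.Adj a b ↔ G.Adj a b :=
      ⟨G.comap Subtype.val, ⟨hG.1.induce_compl_singleton_of_degree_eq_one hv,
        hG.2.comap ⟨Subtype.val, fun h => h⟩ Subtype.val_injective⟩, fun _ _ => Iff.rfl⟩
    have hdeg : ∀ w : {w // w ≠ v},
        (G.degree w : ℤ) = H.degree w + if w = ⟨p, hpv⟩ then 1 else 0 := by
      intro w
      have h1 : (G.degree w : ℤ) = ∑ x, if G.Adj w x then 1 else 0 := by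
        rw [← SimpleGraph.card_neighborFinset_eq_degree, SimpleGraph.neighborFinset_eq_filter]
        exact Finset.natCast_card_filter _ _
      have h2 : (H.degree w : ℤ) = ∑ x, if H.Adj w x then 1 else 0 := by
        rw [← SimpleGraph.card_neighborFinset_eq_degree, SimpleGraph.neighborFinset_eq_filter]
        exact Finset.natCast_card_filter _ _
      rw [h1, h2, Fintype.sum_eq_add_sum_subtype_ne _ v, add_comm]
      simp only [hHG]
      congr 1
      refine if_congr ⟨fun h => Subtype.ext (hp _ h.symm), ?_⟩ rfl rfl
      rintro rfl
      exact hvp.symm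
    have hx := facialVar_ne_zero hu
    have := ih H hH (by
      have := Fintype.sum_eq_add_sum_subtype_ne (fun _ => 1) v
      simp only [Finset.sum_const, smul_eq_mul, mul_one, Finset.card_univ] at this
      omega) ⟨r, hvr.symm⟩ φ
    rw [pow_succ', mul_assoc, ← this, ← (Equiv.funSplitAt v Dot).symm.sum_comp,
      Fintype.sum_prod_type_right, Finset.mul_sum]
    refine Finset.sum_congr (Finset.ext fun _ => by simp) fun σ _ => ?_
    have hσv : ∀ c, (Equiv.funSplitAt v Dot).symm (c, σ) v = c := fun c => by simp
    have hσ : ∀ c (w : {w // w ≠ v}), (Equiv.funSplitAt v Dot).symm (c, σ) w = σ w :=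
      fun c w => by simp [w.2]
    have hprod : ∀ c, ∏ w, facialVar u ((Equiv.funSplitAt v Dot).symm (c, σ) w) ^
        (2 - (G.degree w : ℤ)) = facialVar u c * ((facialVar u (σ ⟨p, hpv⟩))⁻¹ *
          ∏ w, facialVar u (σ w) ^ (2 - (H.degree w : ℤ))) := by
      intro c
      rw [Fintype.prod_eq_mul_prod_subtype_ne _ v, hσv, hv]
      congr 1
      · norm_num
      · have : (facialVar u (σ ⟨p, hpv⟩))⁻¹ =
            ∏ w, if w = ⟨p, hpv⟩ then (facialVar u (σ w))⁻¹ else 1 := by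
          rw [Finset.prod_ite_eq' Finset.univ]; simp
        rw [this, ← Finset.prod_mul_distrib]
        refine Finset.prod_congr rfl fun w _ => ?_
        rw [hσ, hdeg w]
        split_ifs with hw
        · rw [← zpow_neg_one, ← zpow_add₀ (hx _)]; congr 1; ring
        · simp
    have hforb : ∀ c, (∃ v' w', G.Adj v' w' ∧ (Equiv.funSplitAt v Dot).symm (c, σ) v' = .black ∧
        (Equiv.funSplitAt v Dot).symm (c, σ) w' = .black) ↔
        (∃ v' w', H.Adj v' w' ∧ σ v' = .black ∧ σ w' = .black) ∨
          (c = .black ∧ σ ⟨p, hpv⟩ = .black) := by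
      intro c
      constructor
      · rintro ⟨a, b, hab, ha, hb⟩
        by_cases hav : a = v
        · subst hav
          obtain rfl := hp _ hab
          exact Or.inr ⟨(hσv c).symm.trans ha, (hσ c ⟨b, hpv⟩).symm.trans hb⟩
        · by_cases hbv : b = v
          · subst hbv
            obtain rfl := hp _ hab.symm
            exact Or.inr ⟨(hσv c).symm.trans hb, (hσ c ⟨a, hpv⟩).symm.trans ha⟩
          · exact Or.inl ⟨⟨a, hav⟩, ⟨b, hbv⟩, (hHG _ _).2 hab, (hσ c ⟨a, hav⟩).symm.trans ha,
              (hσ c ⟨b, hbv⟩).symm.trans hb⟩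
      · rintro (⟨a, b, hab, ha, hb⟩ | ⟨hc, hp'⟩)
        · exact ⟨a, b, (hHG _ _).1 hab, (hσ c a).trans ha, (hσ c b).trans hb⟩
        · exact ⟨v, p, hvp, (hσv c).trans hc, (hσ c ⟨p, hpv⟩).trans hp'⟩
    simp only [hprod, hforb, hσ _ ⟨r, hvr.symm⟩, Dot.sum_univ]
    by_cases hF : ∃ v' w', H.Adj v' w' ∧ σ v' = .black ∧ σ w' = .black
    · simp only [hF, true_or, if_true, zero_mul, mul_zero, add_zero]
    · simp only [hF, false_or, reduceCtorEq, false_and, true_and, if_false]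
      cases hc : σ ⟨p, hpv⟩ with
      | white =>
        simp only [reduceCtorEq, if_false]
        simp only [facialVar, inv_one]
        ring
      | black =>
        simp only [if_true, facialVar_black_inv hu]
        simp only [facialVar]
        ring

/-! ### Partly smoothed diagrams -/

/-- A diagram on the sphere on a fixed set `D` of strand ends, joined in pairs by `join`, some of
whose crossings were smoothed; those in `S` remain, the crossing `c` having the ends `e c i` in
anticlockwise order.  All ends that do not belong to a remaining crossing lie at points
with two ends.  The Euler characteristics `χ` of the faces are part of the data.  They are only
bounded above, by the number of boundary walks; equality for the fully smoothed diagram is a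
consequence. -/
structure SmoothedDiagram {D X : Type*} (join : Equiv.Perm D) (e : X → ZMod 4 → D)
    (S : Finset X) (F : Type*) [Fintype F] where
  /-- The next end, anticlockwise, at the same vertex. -/
  turn : Equiv.Perm D
  /-- The face in the corner between an end and the next one. -/
  face : D → F
  /-- The Euler characteristic of a face. -/
  χ : F → ℤ
  turn_end : ∀ c ∈ S, ∀ i, turn (e c i) = e c (i + 1)
  turn_turn : ∀ d, (∀ c ∈ S, ∀ i, d ≠ e c i) → turn (turn d) = d
  face_walk : ∀ d, face (turn.symm (join d)) = face d
  face_surjective : Function.Surjective face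
  connected : ∀ d d', Relation.EqvGen (fun a b => b = join a ∨ face a = face b) d d'
  χ_le : ∀ f, χ f ≤ 2 - (cycleCount (join.trans turn.symm) (face ⁻¹' {f}) : ℤ)
  euler : ∑ f, χ f = 2 + (S.card : ℤ)

open Classical in
/-- The sum over all states `σ` of a weight that depends on the symbols in the corners, times the
contributions of all faces. -/
noncomputable def stateSum {D F : Type*} [Fintype F] (face : D → F) (χ : F → ℤ) (u : ℂ)
    (g : (D → Dot) → ℂ) : ℂ :=
  ∑ σ : F → Dot, g (σ ∘ face) * ∏ f, facialVar u (σ f) ^ χ f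

namespace SmoothedDiagram

variable {D X F : Type*} [Fintype F] {join : Equiv.Perm D} {e : X → ZMod 4 → D} {S : Finset X}

theorem face_join_end (E : SmoothedDiagram join e S F) (hjoin : ∀ d, join (join d) = d) {c : X}
    (hc : c ∈ S) (i : ZMod 4) : E.face (join (e c (i + 1))) = E.face (e c i) := by
  rw [← E.face_walk (join (e c (i + 1))), hjoin, ← E.turn_end c hc i, Equiv.symm_apply_apply]

variable [DecidableEq D] [DecidableEq X]

/-- Exchanging the successors of two opposite elements turns the cycle of all four elements of
`ZMod 4` into two transpositions. -/
theorem smoothed_turn_turn : ∀ i j : ZMod 4,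
    (if (if i = j then j + 3 else if i = j + 2 then j + 1 else i + 1) = j then j + 3
      else if (if i = j then j + 3 else if i = j + 2 then j + 1 else i + 1) = j + 2 then j + 1
      else (if i = j then j + 3 else if i = j + 2 then j + 1 else i + 1) + 1) = i := by
  decide

/-- The diagram that results from joining the opposite corners `e c j` and `e c (j + 2)` of the
crossing `c` by a band, where `π` identifies the two faces. -/
def smooth {c : X} (hcS : c ∉ S) (he : Function.Injective2 e)
    (E : SmoothedDiagram join e (insert c S) F) (j : ZMod 4) {F' : Type*} [Fintype F']
    (π : F → F') (hπ : Function.Surjective π)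
    (hEW : π (E.face (e c j)) = π (E.face (e c (j + 2)))) (χ' : F' → ℤ)
    (hle : ∀ f, χ' f ≤ 2 - (cycleCount (Equiv.swap (e c j) (e c (j + 2)) *
      (join.trans E.turn.symm)) (π ∘ E.face ⁻¹' {f}) : ℤ))
    (hsum : ∑ f, χ' f = ∑ f, E.χ f - 1) : SmoothedDiagram join e S F' where
  turn := E.turn * Equiv.swap (e c j) (e c (j + 2))
  face := π ∘ E.face
  χ := χ'
  turn_end c' hc' i := by
    have hne : c' ≠ c := fun h => hcS (h ▸ hc')
    rw [Equiv.Perm.mul_apply, Equiv.swap_apply_of_ne_of_ne (fun h => hne (he h).1)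
      (fun h => hne (he h).1), E.turn_end c' (Finset.mem_insert_of_mem hc')]
  turn_turn d hd := by
    have hturn := E.turn_end c (Finset.mem_insert_self c S)
    by_cases hdc : ∃ i, d = e c i
    · obtain ⟨i, rfl⟩ := hdc
      have hinj : ∀ i k, e c i = e c k ↔ i = k := fun i k => ⟨fun h => (he h).2, fun h => h ▸ rfl⟩
      have key : ∀ i, (E.turn * Equiv.swap (e c j) (e c (j + 2))) (e c i) =
          e c (if i = j then j + 3 else if i = j + 2 then j + 1 else i + 1) := by
        intro i
        simp only [Equiv.Perm.mul_apply, Equiv.swap_apply_def, hinj]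
        split_ifs
        · rw [hturn]; congr 1; ring
        · rw [hturn]
        · rw [hturn]
      rw [key, key]
      congr 1
      exact smoothed_turn_turn i j
    · push Not at hdc
      have hdS : ∀ c' ∈ insert c S, ∀ i, d ≠ e c' i := by
        intro c' hc' i
        rcases Finset.mem_insert.1 hc' with rfl | h
        · exact hdc i
        · exact hd c' h i
      -- Ends of a remaining crossing follow each other, so `turn d` is not one of them either.
      have hturn_ne : ∀ i, E.turn d ≠ e c i := by
        intro i h
        rw [← sub_add_cancel i 1, ← hturn] at h
        exact hdc _ (E.turn.injective h)
      rw [Equiv.Perm.mul_apply, Equiv.Perm.mul_apply,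
        Equiv.swap_apply_of_ne_of_ne (hdc _) (hdc _),
        Equiv.swap_apply_of_ne_of_ne (hturn_ne _) (hturn_ne _), E.turn_turn d hdS]
  face_walk d := by
    have h : (E.turn * Equiv.swap (e c j) (e c (j + 2))).symm (join d) =
        Equiv.swap (e c j) (e c (j + 2)) (E.turn.symm (join d)) := by
      rw [Equiv.symm_apply_eq]
      simp
    rw [Function.comp, Function.comp, h, ← E.face_walk d]
    rcases eq_or_ne (E.turn.symm (join d)) (e c j) with h1 | h1
    · rw [h1, Equiv.swap_apply_left, hEW]
    · rcases eq_or_ne (E.turn.symm (join d)) (e c (j + 2)) with h2 | h2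
      · rw [h2, Equiv.swap_apply_right, hEW]
      · rw [Equiv.swap_apply_of_ne_of_ne h1 h2]
  face_surjective := hπ.comp E.face_surjective
  connected d d' := (E.connected d d').mono fun a b h =>
    h.imp_right fun h' => congrArg π h'
  χ_le := by
    have h : join.trans (E.turn * Equiv.swap (e c j) (e c (j + 2))).symm =
        Equiv.swap (e c j) (e c (j + 2)) * (join.trans E.turn.symm) := by
      ext d
      simp only [Equiv.trans_apply, Equiv.Perm.mul_apply]
      rw [Equiv.symm_apply_eq]
      simp
    rw [h]
    exact hle
  euler := by
    rw [hsum, E.euler, Finset.card_insert_of_notMem hcS]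
    push_cast
    ring

/-- A crossing can be smoothed on the level of state sums: states for which two opposite corners
have the same symbol `i`, with weight `x_i⁻¹`, correspond to the states of the smoothed diagram. -/
theorem exists_smooth [Finite D] {u : ℂ} (hu : IsPrimitiveRoot u 5) {F : Type v} [Fintype F]
    {c : X} (hcS : c ∉ S) (he : Function.Injective2 e)
    (E : SmoothedDiagram join e (insert c S) F) (j : ZMod 4) :
    ∃ (F' : Type v) (_ : Fintype F') (E' : SmoothedDiagram join e S F'),
      ∀ g : (D → Dot) → ℂ, stateSum E.face E.χ u (fun ρ =>
        (if ρ (e c j) = ρ (e c (j + 2)) then (facialVar u (ρ (e c j)))⁻¹ else 0) * g ρ) =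
          stateSum E'.face E'.χ u g := by
  classical
  have hx := facialVar_ne_zero hu
  set a := e c j with ha
  set b := e c (j + 2) with hb
  have hwalk : ∀ f, ∀ x ∈ E.face ⁻¹' {f}, (join.trans E.turn.symm) x ∈ E.face ⁻¹' {f} :=
    fun f x hxf => (E.face_walk x).trans hxf
  by_cases hab : E.face a = E.face b
  · -- The band joins a face to itself and lowers its Euler characteristic by one.
    have hle : ∀ f, (fun f => E.χ f - if f = E.face a then 1 else 0) f ≤
        2 - (cycleCount (Equiv.swap (e c j) (e c (j + 2)) *
          (join.trans E.turn.symm)) (id ∘ E.face ⁻¹' {f}) : ℤ) := by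
      intro f
      have h1 := E.χ_le f
      rw [Function.id_comp, ← ha, ← hb]
      by_cases hf : f = E.face a
      · have h2 := cycleCount_swap_mul_le (a := a) (b := b) (hwalk f)
        simp only [hf, if_true] at h1 h2 ⊢
        omega
      · have h2 := cycleCount_swap_mul_le_of_notMem (a := a) (b := b) (hwalk f)
          (fun h => hf (Eq.symm h)) (fun h => hf (hab.trans h).symm)
        simp only [hf, if_false]
        omega
    refine ⟨F, inferInstance, E.smooth hcS he j id Function.surjective_id hab
      (fun f => E.χ f - if f = E.face a then 1 else 0) hle (by simp [Finset.sum_sub_distrib]),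
      fun g => ?_⟩
    refine Finset.sum_congr rfl fun σ _ => ?_
    have h1 : ∏ f, facialVar u (σ f) ^ (E.χ f - if f = E.face a then 1 else 0) =
        (facialVar u (σ (E.face a)))⁻¹ * ∏ f, facialVar u (σ f) ^ E.χ f := by
      have : (facialVar u (σ (E.face a)))⁻¹ =
          ∏ f, if f = E.face a then (facialVar u (σ f))⁻¹ else 1 := by
        rw [Finset.prod_ite_eq' Finset.univ]; simp
      rw [this, ← Finset.prod_mul_distrib]
      refine Finset.prod_congr rfl fun f _ => ?_
      split_ifs
      · rw [zpow_sub_one₀ (hx _), mul_comm]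
      · simp
    simp only [smooth, Function.id_comp]
    rw [h1]
    simp only [Function.comp, hab, if_true]
    ring
  · -- The band joins the face `p` to another one, which is dropped from the set of faces.
    obtain ⟨p, hp⟩ : ∃ p : {f // f ≠ E.face b}, p.1 = E.face a := ⟨⟨_, hab⟩, rfl⟩
    let π : F → {f // f ≠ E.face b} := fun f => if h : f = E.face b then p else ⟨f, h⟩
    have hπb : π (E.face b) = p := dif_pos rfl
    have hπv : ∀ f : {f // f ≠ E.face b}, π f = f := fun f => dif_neg f.2
    have hπa : π (E.face a) = p := by rw [← hp, hπv]
    have hπ : Function.Surjective π := fun f => ⟨f, hπv f⟩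
    let χ' : {f // f ≠ E.face b} → ℤ := fun f =>
      E.χ f + if f = p then E.χ (E.face b) - 1 else 0
    have hle : ∀ f, χ' f ≤ 2 - (cycleCount (Equiv.swap (e c j) (e c (j + 2)) *
          (join.trans E.turn.symm)) (π ∘ E.face ⁻¹' {f}) : ℤ) := by
      intro f
      rw [← ha, ← hb]
      by_cases hf : f = p
      · subst hf
        have hset : π ∘ E.face ⁻¹' {f} = E.face ⁻¹' {E.face a} ∪ E.face ⁻¹' {E.face b} := by
          ext d
          simp only [Set.mem_preimage, Function.comp, Set.mem_singleton_iff, Set.mem_union]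
          by_cases hd : E.face d = E.face b
          · simp [hd, hπb]
          · rw [show π (E.face d) = ⟨E.face d, hd⟩ from dif_neg hd, Subtype.ext_iff, hp]
            simp [hd]
        have h1 := cycleCount_swap_mul_union (a := a) (b := b) (s := E.face ⁻¹' {E.face a})
          (t := E.face ⁻¹' {E.face b}) (hwalk _)
          (Set.disjoint_left.2 fun x hxa hxb => hab (Eq.trans (Eq.symm hxa) hxb)) rfl rfl
        have h2 := E.χ_le (E.face a)
        have h3 := E.χ_le (E.face b)
        rw [hset]
        simp only [χ', if_true, hp]
        omega
      · have hset : π ∘ E.face ⁻¹' {f} = E.face ⁻¹' {f.1} := by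
          ext d
          simp only [Set.mem_preimage, Function.comp, Set.mem_singleton_iff]
          by_cases hd : E.face d = E.face b
          · simp only [hd, hπb, Ne.symm hf, f.2.symm]
          · rw [show π (E.face d) = ⟨E.face d, hd⟩ from dif_neg hd, Subtype.ext_iff]
        have h1 := cycleCount_swap_mul_le_of_notMem (a := a) (b := b) (hwalk f.1)
          (fun h => hf (Subtype.ext (hp.trans h).symm)) (fun h => f.2 (Eq.symm h))
        have h2 := E.χ_le f
        rw [hset]
        simp only [χ', hf, if_false]
        omega
    have hsum : ∑ f, χ' f = ∑ f, E.χ f - 1 := by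
      rw [Fintype.sum_eq_add_sum_subtype_ne _ (E.face b), Finset.sum_add_distrib,
        Finset.sum_ite_eq' Finset.univ]
      simp only [Finset.mem_univ, if_true]
      ring
    refine ⟨{f // f ≠ E.face b}, inferInstance,
      E.smooth hcS he j π hπ (hπa.trans hπb.symm) χ' hle hsum, fun g => ?_⟩
    rw [stateSum, stateSum, ← (Equiv.funSplitAt (E.face b) Dot).symm.sum_comp,
      Fintype.sum_prod_type_right]
    refine Finset.sum_congr (Finset.ext fun _ => by simp) fun σ _ => ?_
    have hσb : ∀ i, (Equiv.funSplitAt (E.face b) Dot).symm (i, σ) (E.face b) = i :=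
      fun i => by simp
    have hσ : ∀ i (f : {f // f ≠ E.face b}),
        (Equiv.funSplitAt (E.face b) Dot).symm (i, σ) f = σ f := fun i f => by simp [f.2]
    have hσa : ∀ i, (Equiv.funSplitAt (E.face b) Dot).symm (i, σ) (E.face a) = σ p :=
      fun i => by rw [← hp, hσ]
    rw [Finset.sum_eq_single (σ p)]
    · have hcomp : (Equiv.funSplitAt (E.face b) Dot).symm (σ p, σ) ∘ E.face =
          σ ∘ (π ∘ E.face) := by
        ext1 d
        simp only [Function.comp]
        by_cases hd : E.face d = E.face b
        · rw [hd, hσb, hπb]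
        · rw [show π (E.face d) = ⟨E.face d, hd⟩ from dif_neg hd]
          exact hσ _ ⟨E.face d, hd⟩
      have hprod : ∏ f, facialVar u (σ f) ^ χ' f =
          (facialVar u (σ p) ^ (E.χ (E.face b) - 1)) * ∏ f, facialVar u (σ f) ^ E.χ f := by
        have : facialVar u (σ p) ^ (E.χ (E.face b) - 1) =
            ∏ f, if f = p then facialVar u (σ f) ^ (E.χ (E.face b) - 1) else 1 := by
          rw [Finset.prod_ite_eq' Finset.univ]; simp
        rw [this, ← Finset.prod_mul_distrib]
        refine Finset.prod_congr rfl fun f _ => ?_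
        simp only [χ']
        split_ifs
        · rw [zpow_add₀ (hx _), mul_comm]
        · simp
      rw [Fintype.prod_eq_mul_prod_subtype_ne _ (E.face b), hcomp, hσb]
      simp only [hσ]
      simp only [smooth, Function.comp, hπa, hπb, if_true]
      rw [hprod, zpow_sub_one₀ (hx _)]
      ring
    · intro i _ hi
      simp only [Function.comp, hσa, hσb, if_neg (Ne.symm hi), zero_mul]
    · simp

end SmoothedDiagram

namespace SmoothedDiagram

variable {D X F : Type*} [Fintype F] {join : Equiv.Perm D} {e : X → ZMod 4 → D} {S : Finset X}

/-! ### Fully smoothed diagrams -/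

/-- The dual graph of a diagram: its vertices are the faces, and two distinct faces are adjacent if
they lie on both sides of an edge. -/
def dualGraph (E : SmoothedDiagram join e S F) (hjoin : ∀ d, join (join d) = d) :
    SimpleGraph F where
  Adj f g := f ≠ g ∧ ∃ d, E.face d = f ∧ E.face (join d) = g
  symm := ⟨by
    rintro f g ⟨hne, d, rfl, rfl⟩
    exact ⟨hne.symm, join d, rfl, by rw [hjoin]⟩⟩
  loopless := ⟨fun f h => h.1 rfl⟩

theorem dualGraph_connected (E : SmoothedDiagram join e S F) (hjoin : ∀ d, join (join d) = d)
    [Nonempty D] : (E.dualGraph hjoin).Connected := by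
  have key : ∀ d d', (E.dualGraph hjoin).Reachable (E.face d) (E.face d') := by
    intro d d'
    induction E.connected d d' with
    | rel a b h =>
      rcases h with rfl | h
      · by_cases hab : E.face a = E.face (join a)
        · rw [← hab]
        · exact SimpleGraph.Adj.reachable ⟨hab, a, rfl, rfl⟩
      · rw [h]
    | refl => rfl
    | symm _ _ _ h => exact h.symm
    | trans _ _ _ _ _ h h' => exact h.trans h'
  refine (SimpleGraph.connected_iff _).2 ⟨fun f g => ?_, ⟨E.face (Classical.arbitrary D)⟩⟩
  obtain ⟨d, rfl⟩ := E.face_surjective f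
  obtain ⟨d', rfl⟩ := E.face_surjective g
  exact key d d'

/-- In a fully smoothed diagram, the face beyond the boundary stays the same along a boundary
walk. -/
theorem face_join_walk (E : SmoothedDiagram join e ∅ F) (hjoin : ∀ d, join (join d) = d) (d : D) :
    E.face (join (E.turn.symm (join d))) = E.face (join d) := by
  have h1 : E.turn.symm (E.turn.symm (join d)) = join d := by
    rw [Equiv.symm_apply_eq, Equiv.symm_apply_eq]
    exact (E.turn_turn _ (by simp)).symm
  rw [← E.face_walk (join (E.turn.symm (join d))), hjoin, h1]

open Classical in
theorem degree_dualGraph_le [Finite D] (E : SmoothedDiagram join e ∅ F)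
    (hjoin : ∀ d, join (join d) = d) (f : F) :
    (E.dualGraph hjoin).degree f + (if ∃ d, E.face d = f ∧ E.face (join d) = f then 1 else 0) ≤
      cycleCount (join.trans E.turn.symm) (E.face ⁻¹' {f}) := by
  have hle := ncard_image_le_cycleCount (w := join.trans E.turn.symm) (s := E.face ⁻¹' {f})
    (g := fun d => E.face (join d)) (fun x hx => (E.face_walk x).trans hx)
    (fun x _ => E.face_join_walk hjoin x)
  refine le_trans ?_ hle
  rw [← SimpleGraph.card_neighborFinset_eq_degree, ← Set.ncard_coe_finset]
  have hsub : ((E.dualGraph hjoin).neighborFinset f : Set F) ⊆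
      (fun d => E.face (join d)) '' (E.face ⁻¹' {f}) := by
    intro g hg
    obtain ⟨-, d, hd, hd'⟩ := (SimpleGraph.mem_neighborFinset _ _ _).1 (Finset.mem_coe.1 hg)
    exact ⟨d, hd, hd'⟩
  split_ifs with h
  · obtain ⟨d, hd, hd'⟩ := h
    rw [← Set.ncard_insert_of_notMem (a := f) (by simp) (Set.toFinite _)]
    exact Set.ncard_le_ncard (Set.insert_subset ⟨d, hd, hd'⟩ hsub) (Set.toFinite _)
  · exact Set.ncard_le_ncard hsub (Set.toFinite _)

open Classical in
/-- The circles of a fully smoothed diagram on the sphere have a tree as dual graph.  Indeed, the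
Euler characteristics add up to `2` and are at most `2` minus the degrees, but a connected graph has
no more than one vertex in excess of its edges. -/
theorem dualGraph_isTree [Finite D] [Nonempty D] (E : SmoothedDiagram join e ∅ F)
    (hjoin : ∀ d, join (join d) = d) :
    (E.dualGraph hjoin).IsTree ∧ (∀ f, E.χ f = 2 - ((E.dualGraph hjoin).degree f : ℤ)) ∧
      ∀ d, E.face d ≠ E.face (join d) := by
  have hconn := E.dualGraph_connected hjoin
  have hcard := hconn.card_vert_le_card_edgeSet_add_one
  rw [Nat.card_eq_fintype_card, Nat.card_eq_fintype_card, ← SimpleGraph.edgeFinset_card] at hcard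
  have hdeg := (E.dualGraph hjoin).sum_degrees_eq_twice_card_edges
  have hsum := E.euler
  have hle : ∀ f, 0 ≤ 2 - ((E.dualGraph hjoin).degree f : ℤ) -
      (if ∃ d, E.face d = f ∧ E.face (join d) = f then 1 else 0) - E.χ f := by
    intro f
    have h1 := E.degree_dualGraph_le hjoin f
    have h2 := E.χ_le f
    split_ifs at h1 ⊢ <;> omega
  have hite : ∀ f, (0 : ℤ) ≤ if ∃ d, E.face d = f ∧ E.face (join d) = f then 1 else 0 := by
    intro f
    split_ifs <;> norm_num
  have hsumite := Finset.sum_nonneg fun f (_ : f ∈ Finset.univ) => hite f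
  have htotal : ∑ f, (2 - ((E.dualGraph hjoin).degree f : ℤ) -
      (if ∃ d, E.face d = f ∧ E.face (join d) = f then 1 else 0) - E.χ f) =
      2 * Fintype.card F - 2 * (E.dualGraph hjoin).edgeFinset.card -
      (∑ f, if ∃ d, E.face d = f ∧ E.face (join d) = f then 1 else 0) - 2 := by
    rw [Finset.sum_sub_distrib, Finset.sum_sub_distrib, Finset.sum_sub_distrib, hsum,
      ← Nat.cast_sum, hdeg, Finset.card_empty, Finset.sum_const, Finset.card_univ]
    push_cast
    ring
  have hnonneg := Finset.sum_nonneg fun f (_ : f ∈ Finset.univ) => hle f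
  have hzero := (Finset.sum_eq_zero_iff_of_nonneg (s := Finset.univ) fun f _ => hle f).1
    (by omega)
  have hitezero := (Finset.sum_eq_zero_iff_of_nonneg (s := Finset.univ) fun f _ => hite f).1
    (by omega)
  refine ⟨SimpleGraph.isTree_iff_connected_and_card.2 ⟨hconn, ?_⟩, fun f => ?_, fun d hd => ?_⟩
  · rw [Nat.card_eq_fintype_card, Nat.card_eq_fintype_card, ← SimpleGraph.edgeFinset_card]
    omega
  · have h1 := hzero f (Finset.mem_univ f)
    have h2 := hitezero f (Finset.mem_univ f)
    omega
  · have h := hitezero (E.face d) (Finset.mem_univ _)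
    rw [if_pos ⟨d, rfl, hd.symm⟩] at h
    norm_num at h

/-! ### Evaluation of the state sums -/

open Classical in
/-- The weight of the symbols `ρ` in the corners: a function `φ` of the symbol at `r`, times the
variables of the crossings in `S`, or zero if two symbols beside an edge are black. -/
noncomputable def cornerWeight (join : Equiv.Perm D) (e : X → ZMod 4 → D) (S : Finset X) (u : ℂ)
    (r : D) (φ : Dot → ℂ) (ρ : D → Dot) : ℂ :=
  if ∃ d, ρ d = .black ∧ ρ (join d) = .black then 0 else
    φ (ρ r) * ∏ c ∈ S, crossingVar u (ρ (e c 0)) (ρ (e c 1)) (ρ (e c 2)) (ρ (e c 3))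

open Classical in
theorem cornerWeight_insert [DecidableEq X] {u : ℂ} (hu : IsPrimitiveRoot u 5)
    (hjoin : ∀ d, join (join d) = d) {c : X} (hcS : c ∉ S)
    (E : SmoothedDiagram join e (insert c S) F) (r : D) (φ : Dot → ℂ) (σ : F → Dot) :
    cornerWeight join e (insert c S) u r φ (σ ∘ E.face) =
      - u ^ 3 * ((if (σ ∘ E.face) (e c 0) = (σ ∘ E.face) (e c (0 + 2)) then
        (facialVar u ((σ ∘ E.face) (e c 0)))⁻¹ else 0) *
          cornerWeight join e S u r φ (σ ∘ E.face)) +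
      - u ^ 2 * ((if (σ ∘ E.face) (e c 1) = (σ ∘ E.face) (e c (1 + 2)) then
        (facialVar u ((σ ∘ E.face) (e c 1)))⁻¹ else 0) *
          cornerWeight join e S u r φ (σ ∘ E.face)) := by
  by_cases h : ∃ d, (σ ∘ E.face) d = .black ∧ (σ ∘ E.face) (join d) = .black
  · simp only [cornerWeight, if_pos h, mul_zero, add_zero]
  · have hadj : ∀ i, ¬ ((σ ∘ E.face) (e c i) = .black ∧ (σ ∘ E.face) (e c (i + 1)) = .black) := by
      rintro i ⟨h1, h2⟩
      refine h ⟨e c (i + 1), h2, ?_⟩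
      rw [Function.comp, E.face_join_end hjoin (Finset.mem_insert_self c S)]
      exact h1
    simp only [cornerWeight, if_neg h, Finset.prod_insert hcS]
    have h01 := hadj 0
    have h12 := hadj 1
    have h23 := hadj 2
    have h30 := hadj 3
    simp only [show (0 + 1 : ZMod 4) = 1 from rfl, show (0 + 2 : ZMod 4) = 2 from rfl,
      show (1 + 1 : ZMod 4) = 2 from rfl, show (1 + 2 : ZMod 4) = 3 from rfl,
      show (2 + 1 : ZMod 4) = 3 from rfl,
      show (3 + 1 : ZMod 4) = 0 from rfl] at h01 h12 h23 h30 ⊢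
    rw [crossingVar_eq hu h01 h12 h23 h30]
    ring

/-- If the symbol of a single face is given an additional weight `φ`, the state sum of a diagram is
a multiple of that of a sphere without any strands; the factor lies in `ℤ[u]` and depends neither on
`φ` nor on the face. -/
theorem exists_stateSum_eq [Finite D] [Nonempty D] {u : ℂ} (hu : IsPrimitiveRoot u 5)
    (hjoin : ∀ d, join (join d) = d) (he : Function.Injective2 e) (S : Finset X) :
    ∀ {F : Type v} [Fintype F] (E : SmoothedDiagram join e S F),
      ∃ K ∈ Algebra.adjoin ℤ {u}, ∀ (r : D) (φ : Dot → ℂ),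
        stateSum E.face E.χ u (cornerWeight join e S u r φ) =
          K * (φ .white + φ .black * facialVar u .black ^ 2) := by
  classical
  have huA : u ∈ Algebra.adjoin ℤ {u} := Algebra.subset_adjoin rfl
  induction S using Finset.induction_on with
  | empty =>
    intro F _ E
    obtain ⟨htree, hχ, hne⟩ := E.dualGraph_isTree hjoin
    obtain ⟨n, hn⟩ : ∃ n, Fintype.card F = n + 1 :=
      Nat.exists_eq_succ_of_ne_zero
        (Fintype.card_pos_iff.2 (Nonempty.map E.face inferInstance)).ne'
    refine ⟨(1 + facialVar u .black) ^ n, pow_mem (add_mem (one_mem _)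
      (add_mem (pow_mem huA 2) (pow_mem huA 3))) n, fun r φ => ?_⟩
    rw [← sum_states_tree hu n (E.dualGraph hjoin) htree hn (E.face r) φ]
    refine Finset.sum_congr rfl fun σ _ => ?_
    simp only [hχ]
    congr 1
    simp only [cornerWeight, Finset.prod_empty, mul_one, Function.comp]
    refine if_congr ⟨?_, ?_⟩ rfl rfl
    · rintro ⟨d, h1, h2⟩
      exact ⟨_, _, ⟨hne d, d, rfl, rfl⟩, h1, h2⟩
    · rintro ⟨_, _, ⟨-, d, rfl, rfl⟩, h1, h2⟩
      exact ⟨d, h1, h2⟩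
  | insert c S hcS ih =>
    intro F _ E
    obtain ⟨F₁, _, E₁, h₁⟩ := E.exists_smooth hu hcS he 0
    obtain ⟨F₂, _, E₂, h₂⟩ := E.exists_smooth hu hcS he 1
    obtain ⟨K₁, hK₁, hE₁⟩ := ih E₁
    obtain ⟨K₂, hK₂, hE₂⟩ := ih E₂
    refine ⟨- u ^ 3 * K₁ + - u ^ 2 * K₂, add_mem (mul_mem (neg_mem (pow_mem huA 3)) hK₁)
      (mul_mem (neg_mem (pow_mem huA 2)) hK₂), fun r φ => ?_⟩
    rw [add_mul, mul_assoc, mul_assoc, ← hE₁ r φ, ← hE₂ r φ, ← h₁, ← h₂]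
    simp only [stateSum, cornerWeight_insert hu hjoin hcS, Finset.mul_sum]
    rw [← Finset.sum_add_distrib]
    refine Finset.sum_congr rfl fun σ _ => ?_
    ring

end SmoothedDiagram

/-! ### Long links -/

namespace LongLink

variable {X P F : Type*} [Fintype X] [Fintype P] [Fintype F]

/-- A long link, as a diagram none of whose crossings are smoothed. -/
noncomputable def toSmoothedDiagram (T : LongLink X P F) :
    SmoothedDiagram T.join (fun c i => (Sum.inl (c, i) : StrandEnd X P)) Finset.univ F where
  turn := StrandEnd.turn X P
  face := T.face
  χ := T.eulerChar
  turn_end _ _ _ := rfl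
  turn_turn d hd := by
    rcases d with ⟨c, i⟩ | ⟨p, i⟩
    · exact absurd rfl (hd c (Finset.mem_univ c) i)
    · have h : ∀ i : ZMod 2, i + 1 + 1 = i := by decide
      exact congrArg (fun k => Sum.inr (p, k)) (h i)
  face_walk := T.face_walk
  face_surjective := T.face_surjective
  connected d d' := by
    -- The edge at the next end leads back to the face in the corner before it.
    have hturn : ∀ d, T.face (T.join (StrandEnd.turn X P d)) = T.face d := by
      intro d
      rw [← T.face_walk (T.join _)]
      simp [StrandEnd.walk, T.join_join]
    induction T.connected d d' with
    | rel a b h =>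
      rcases h with rfl | h
      · refine (Relation.EqvGen.rel a (T.join (StrandEnd.turn X P a)) (Or.inr (hturn a).symm)).trans
          _ _ _ (Relation.EqvGen.rel _ _ (Or.inl (T.join_join _).symm))
      · exact Relation.EqvGen.rel _ _ h
    | refl => exact Relation.EqvGen.refl _
    | symm _ _ _ h => exact h.symm
    | trans _ _ _ _ _ h h' => exact h.trans _ _ _ h'
  χ_le f := by
    have h : StrandEnd.boundaryCount T.join T.face f =
        cycleCount (T.join.trans (StrandEnd.turn X P).symm) (T.face ⁻¹' {f}) := by
      rw [cycleCount, ← Nat.card_coe_set_eq]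
      exact Nat.card_congr (Equiv.subtypeEquivRight fun w => exists_congr fun d => and_comm)
    rw [eulerChar, h]
  euler := by
    have := T.euler
    simp only [eulerChar, Finset.card_univ]
    linarith

open Classical in
/-- The contribution of a state without dots, which is zero if the state is forbidden. -/
noncomputable def stateWeight (T : LongLink X P F) (u : ℂ) (σ : F → Dot) : ℂ :=
  if T.Forbidden σ then 0 else
    (∏ c, T.crossingFactor u σ c) * ∏ f, facialVar u (σ f) ^ T.eulerChar f

open Classical in
theorem exists_sum_stateWeight_eq (T : LongLink X P F) {u : ℂ} (hu : IsPrimitiveRoot u 5) :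
    ∃ K ∈ Algebra.adjoin ℤ {u}, ∀ (r : StrandEnd X P) (φ : Dot → ℂ),
      ∑ σ, φ (σ (T.face r)) * T.stateWeight u σ =
        K * (φ .white + φ .black * facialVar u .black ^ 2) := by
  have : Nonempty (StrandEnd X P) := ⟨Sum.inr (T.infinity, 0)⟩
  obtain ⟨K, hK, h⟩ := SmoothedDiagram.exists_stateSum_eq hu T.join_join
    (fun a b i k h => by simpa using h) Finset.univ T.toSmoothedDiagram
  refine ⟨K, hK, fun r φ => (Finset.sum_congr rfl fun σ _ => ?_).trans (h r φ)⟩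
  have hforb : T.Forbidden σ ↔ ∃ d, (σ ∘ T.toSmoothedDiagram.face) d = .black ∧
    (σ ∘ T.toSmoothedDiagram.face) (T.join d) = .black := Iff.rfl
  by_cases hF : T.Forbidden σ
  · rw [stateWeight, if_pos hF, SmoothedDiagram.cornerWeight, if_pos (hforb.1 hF), mul_zero,
      zero_mul]
  · rw [stateWeight, if_neg hF, SmoothedDiagram.cornerWeight, if_neg (mt hforb.2 hF), ← mul_assoc]
    rfl

open Classical in
theorem value_eq_sum (T : LongLink X P F) (u : ℂ) : T.value u = ∑ σ, T.stateWeight u σ := by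
  refine Finset.sum_congr (Finset.ext fun _ => by simp) fun σ _ => ?_
  by_cases h : T.Forbidden σ <;> simp [stateWeight, facialFactor, h]

open Classical in
theorem partialValue_single_black (T : LongLink X P F) {u : ℂ} (hu : IsPrimitiveRoot u 5) (r : F) :
    T.partialValue u (PartialState.single r .black) =
      ∑ σ, (if σ r = .black then (facialVar u .black)⁻¹ else 0) * T.stateWeight u σ := by
  refine Finset.sum_congr (Finset.ext fun _ => by simp) fun σ _ => ?_
  have hext : (∀ f, ∀ c ∈ PartialState.single r .black f, σ f = c) ↔ σ r = .black := by
    simp [PartialState.single]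
  have hempty : ∀ f, PartialState.single r .black f = ∅ ↔ f ≠ r := by
    intro f
    simp [PartialState.single, Set.eq_empty_iff_forall_notMem]
  simp only [hext]
  by_cases hr : σ r = .black
  · by_cases h : T.Forbidden σ
    · simp [stateWeight, h]
    · have hprod : ∏ f, T.facialFactor u (PartialState.single r .black) σ f =
          (facialVar u .black)⁻¹ * ∏ f, facialVar u (σ f) ^ T.eulerChar f := by
        have : (facialVar u .black)⁻¹ = ∏ f, if f = r then (facialVar u (σ f))⁻¹ else 1 := by
          rw [Finset.prod_ite_eq' Finset.univ]; simp [hr]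
        rw [this, ← Finset.prod_mul_distrib]
        refine Finset.prod_congr rfl fun f _ => ?_
        by_cases hf : f = r
        · simp only [facialFactor, hempty, hf, ne_eq, not_true_eq_false, if_false, if_true]
          rw [zpow_sub_one₀ (facialVar_ne_zero hu _), mul_comm]
        · simp [facialFactor, hempty, hf]
      simp only [hr, h, not_false_eq_true, and_self, if_true, stateWeight, if_false, hprod]
      ring
  · simp [hr]

open Classical in
theorem partialValue_both_white (T : LongLink X P F) (u : ℂ) (f g : F) :
    T.partialValue u (PartialState.both (PartialState.single f .white)
      (PartialState.single g .white)) =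
      ∑ σ, (if σ f = .white ∧ σ g = .white then 1 else 0) * T.stateWeight u σ := by
  refine Finset.sum_congr (Finset.ext fun _ => by simp) fun σ _ => ?_
  set p := PartialState.both (PartialState.single f .white) (PartialState.single g .white) with hp
  have hmem : ∀ h c, c ∈ p h ↔ (h = f ∨ h = g) ∧ c = .white := by
    intro h c
    simp only [hp, PartialState.both, PartialState.single, Set.mem_union, Set.mem_ofPred_eq]
    tauto
  have hext : (∀ h, ∀ c ∈ p h, σ h = c) ↔ σ f = .white ∧ σ g = .white := by
    simp only [hmem]
    exact ⟨fun H => ⟨H f _ ⟨Or.inl rfl, rfl⟩, H g _ ⟨Or.inr rfl, rfl⟩⟩, by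
      rintro ⟨hf, hg⟩ _ _ ⟨rfl | rfl, rfl⟩ <;> assumption⟩
  simp only [hext]
  by_cases hw : σ f = .white ∧ σ g = .white
  · by_cases hF : T.Forbidden σ
    · simp [stateWeight, hF]
    · have hprod : ∀ h, T.facialFactor u p σ h = facialVar u (σ h) ^ T.eulerChar h := by
        intro h
        by_cases hh : h = f ∨ h = g
        · have hσ : σ h = .white := by rcases hh with rfl | rfl <;> simp [hw]
          simp [facialFactor, hσ, facialVar]
        · have : p h = ∅ := Set.eq_empty_iff_forall_notMem.2 fun c hc => hh ((hmem h c).1 hc).1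
          simp [facialFactor, this]
      simp [hw, hF, stateWeight, hprod]
  · simp [hw]

/-- The two unbounded faces lie on both sides of an edge at infinity. -/
theorem face_join_infinity (T : LongLink X P F) :
    T.face (T.join (Sum.inr (T.infinity, 0))) = T.unboundedFace₂ := by
  rw [unboundedFace₂, ← T.face_walk (T.join _)]
  congr 1
  simp only [StrandEnd.walk, Equiv.trans_apply, T.join_join]
  rw [Equiv.symm_apply_eq]
  rfl

end LongLink

theorem mainTheorem5 {X P F : Type*} [Fintype X] [Fintype P] [Fintype F] (T : LongLink X P F)
    (u : ℂ) (hu : IsPrimitiveRoot u 5) :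
    T.partialValue u (PartialState.single T.unboundedFace₁ Dot.black) =
        T.partialValue u (PartialState.single T.unboundedFace₂ Dot.black) ∧
      T.partialValue u (PartialState.single T.unboundedFace₁ Dot.black) =
        T.partialValue u (PartialState.both (PartialState.single T.unboundedFace₁ Dot.white)
          (PartialState.single T.unboundedFace₂ Dot.white)) ∧
      T.value u = (1 + 2 * (u ^ 2 + u ^ 3)) *
        T.partialValue u (PartialState.single T.unboundedFace₁ Dot.black) ∧
      (1 + 2 * (u ^ 2 + u ^ 3)) ^ 2 = 5 ∧
      ∃ w ∈ Algebra.adjoin ℤ {u}, T.value u = (Real.sqrt 5 : ℂ) * w := by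
  classical
  obtain ⟨K, hK, h⟩ := T.exists_sum_stateWeight_eq hu
  set y := facialVar u .black with hy
  have hy' : u ^ 2 + u ^ 3 = y := rfl
  have hy2 : y ^ 2 = 1 - y := facialVar_black_sq hu
  have hy0 : y ≠ 0 := facialVar_ne_zero hu _
  have hsingle : ∀ r : StrandEnd X P,
      T.partialValue u (PartialState.single (T.face r) Dot.black) = K * y := by
    intro r
    rw [T.partialValue_single_black hu, h r fun c => if c = .black then y⁻¹ else 0]
    simp only [reduceCtorEq, if_false, if_true]
    field_simp
    ring
  have hvalue : T.value u = K * (1 + y ^ 2) := by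
    rw [T.value_eq_sum]
    simpa using h (Sum.inr (T.infinity, 0)) fun _ => 1
  have hblack : ∀ r : StrandEnd X P,
      ∑ σ, (if σ (T.face r) = .black then 1 else 0) * T.stateWeight u σ = K * y ^ 2 := by
    intro r
    simpa using h r fun c => if c = .black then 1 else 0
  -- The unbounded faces are both white in the states where neither is black, since a
  -- state in which both are black is forbidden.
  have hboth : T.partialValue u (PartialState.both
      (PartialState.single T.unboundedFace₁ Dot.white)
      (PartialState.single T.unboundedFace₂ Dot.white)) = K * y := by
    have hb₁ : ∑ σ, (if σ T.unboundedFace₁ = .black then 1 else 0) * T.stateWeight u σ =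
        K * y ^ 2 := hblack _
    have hb₂ : ∑ σ, (if σ T.unboundedFace₂ = .black then 1 else 0) * T.stateWeight u σ =
        K * y ^ 2 := hblack _
    have hsum : T.partialValue u (PartialState.both
        (PartialState.single T.unboundedFace₁ Dot.white)
        (PartialState.single T.unboundedFace₂ Dot.white)) =
        ∑ σ, T.stateWeight u σ -
          ∑ σ, (if σ T.unboundedFace₁ = .black then 1 else 0) * T.stateWeight u σ -
          ∑ σ, (if σ T.unboundedFace₂ = .black then 1 else 0) * T.stateWeight u σ := by
      rw [T.partialValue_both_white, ← Finset.sum_sub_distrib, ← Finset.sum_sub_distrib]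
      refine Finset.sum_congr rfl fun σ _ => ?_
      cases h1 : σ T.unboundedFace₁ <;> cases h2 : σ T.unboundedFace₂ <;> simp
      exact if_pos ⟨Sum.inr (T.infinity, 0), h1, T.face_join_infinity ▸ h2⟩
    rw [hsum, hb₁, hb₂, ← T.value_eq_sum, hvalue]
    linear_combination -K * hy2
  have hsq : (1 + 2 * y) ^ 2 = 5 := by linear_combination 4 * hy2
  have hval : T.value u = (1 + 2 * y) * (K * y) := by
    rw [hvalue]
    linear_combination -K * hy2
  have hw : K * y ∈ Algebra.adjoin ℤ {u} := by
    have huA : u ∈ Algebra.adjoin ℤ {u} := Algebra.subset_adjoin rfl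
    exact mul_mem hK (add_mem (pow_mem huA 2) (pow_mem huA 3))
  have h1 : T.partialValue u (PartialState.single T.unboundedFace₁ Dot.black) = K * y := hsingle _
  have h2 : T.partialValue u (PartialState.single T.unboundedFace₂ Dot.black) = K * y := hsingle _
  rw [hy', h1, h2, hboth]
  refine ⟨rfl, rfl, hval, hsq, ?_⟩
  have h5 : (Real.sqrt 5 : ℂ) ^ 2 = 5 := by
    rw [← Complex.ofReal_pow, Real.sq_sqrt (by norm_num)]
    norm_num
  rcases sq_eq_sq_iff_eq_or_eq_neg.1 (hsq.trans h5.symm) with h | h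
  · exact ⟨K * y, hw, by rw [hval, h]⟩
  · exact ⟨-(K * y), neg_mem hw, by rw [hval, h]; ring⟩
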